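/- **Setting.** Let $d\in\{2,3\}$, let $\Omega\subset\mathbb R^d$ be bounded and open with Lipschitz boundary, $\partial\Omega=\overline{\Gamma_{\rm in}}\cup\overline{\Gamma_1}\cup\overline{\Gamma_2}$ with $\Gamma_{\rm in},\Gamma_1,\Gamma_2$ disjoint, and $\Gamma=\Gamma_{\rm in}\cup\Gamma_2$. Let $z_1=1$, $z_2=-1$, $0<D_m<D_0$, $0<\epsilon_0<\epsilon_m$, $\alpha_0>0$, $p\in\{1,2,\dots\}$, and for $a\in\mathbb R$ put $$D(a)=D_m+\max\{\min\{a^p,1\},0\}(D_0-D_m),\qquad \epsilon(a)=\epsilon_m+\max\{\min\{a^p,1\},0\}(\epsilon_0-\epsilon_m).$$ Let $c_1^\infty,c_2^\infty,g\in H^1(\Omega)$ and let $H^1_{d,0}(\Omega)$ be the set of $w\in H^1(\Omega)$ with trace $0$ on $\Gamma$. *State system.* For a phase field $\phi\in H^1(\Omega)$, a solution is a triple $(c_1,c_2,\psi)\in H^1(\Omega)^3$ with $c_i-c_i^\infty,\ \psi-g\in H^1_{d,0}(\Omega)$ such that for all $s,\zeta\in H^1_{d,0}(\Omega)$ and $i=1,2$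 (the integrals being absolutely convergent) $$\int_\Omega D(\phi)(\nabla c_i+z_ic_i\nabla\psi-\alpha_0c_i\nabla\phi)\cdot\nabla s\,dx=0,\qquad \int_\Omega \epsilon(\phi)\nabla\psi\cdot\nabla\zeta-\Big(\sum_{i=1}^2z_ic_i\Big)\zeta\,dx=0 .$$ *Adjoint system.* Given $\phi$ and $(c_1,c_2,\psi)$, a solution is a triple $(s_1,s_2,\zeta)\in H^1_{d,0}(\Omega)^3$ such that for all $q,\eta\in H^1_{d,0}(\Omega)$ and $i=1,2$ (the integrals being absolutely convergent) $$\int_\Omega D(\phi)\nabla s_i\cdot(\nabla q+z_iq\nabla\psi-\alpha_0q\nabla\phi)+z_iq-z_i\zeta q\,dx=0,$$ $$\int_\Omega\epsilon(\phi)\nabla\zeta\cdot\nabla\eta\,dx+\sum_{i=1}^2\int_\Omega D(\phi)z_ic_i\nabla s_i\cdot\nabla\eta\,dx=0 .$$ **Assumptions.** Let $\phi\in W^{1,\infty}(\Omega)$ and $\theta\in H^1(\Omega)$. For small $t$ let $(\boldsymbol c(\phi+t\theta),\psi(\phi+t\theta))$ be a solution of the state system for the phase field $\phi+t\theta$ such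 that, as $t\to0$, the concentrations $c_i(\phi+t\theta)$ are bounded in $L^\infty(\Omega)$ uniformly in $t$, and $$\|c_i(\phi+t\theta)-c_i(\phi)\|_{H^1(\Omega)}+\|\psi(\phi+t\theta)-\psi(\phi)\|_{H^1(\Omega)}=O(t)$$ (as is the case if the state is Gâteaux differentiable at $\phi$ in the direction $\theta$ as an $H^1(\Omega)$-valued map). Write $c_i=c_i(\phi)$, $\psi=\psi(\phi)$, and let $(s_1,s_2,\zeta)$ solve the adjoint system at $\phi$ and $(c_1,c_2,\psi)$. Assume that $\theta\nabla c_i\cdot\nabla s_i$, $\theta\nabla\psi\cdot\nabla s_i$ and $\theta\nabla\psi\cdot\nabla\zeta$ are integrable over $\Omega$ (for every $\theta\in H^1(\Omega)$ this is automatic if $\nabla c_i,\nabla\psi\in L^4(\Omega)$). **Theorem.** Let $\mathcal J(\boldsymbol c)=-\int_\Omega\sum_{i=1}^2z_ic_i\,dx$. (a) If the assumptions hold for $t\to0^+$, then the function $t\mapsto\mathcal J(\boldsymbol c(\phi+t\theta))$ has a right derivative at $t=0$, equal to $$\begin{aligned}\langle\mathcal J'(\boldsymbol c(\phi)),\theta\rangle=&-\sum_{i=1}^2\int_\Omega\langle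 D'(\phi),\theta\rangle(\nabla c_i+z_ic_i\nabla\psi-\alpha_0c_i\nabla\phi)\cdot\nabla s_i\,dx-\int_\Omega\langle\epsilon'(\phi),\theta\rangle\nabla\psi\cdot\nabla\zeta\,dx\\&+\sum_{i=1}^2\int_\Omega D(\phi)\alpha_0c_i\nabla\theta\cdot\nabla s_i\,dx,\end{aligned}$$ where all the integrals converge absolutely and $\langle D'(\phi),\theta\rangle(x)=\lim_{t\to0^+}\frac{D(\phi(x)+t\theta(x))-D(\phi(x))}{t}$, and likewise for $\epsilon$. (b) If the assumptions hold for $t\to0$ (both signs), and if for almost every $x\in\Omega$ either $\theta(x)=0$ or $D$ and $\epsilon$ are differentiable at $\phi(x)$, then $t\mapsto\mathcal J(\boldsymbol c(\phi+t\theta))$ is differentiable at $t=0$, and its derivative is given by the same formula with $\langle D'(\phi),\theta\rangle=D'(\phi)\theta$ and $\langle\epsilon'(\phi),\theta\rangle=\epsilon'(\phi)\theta$ (both read as $0$ where $\theta=0$). -/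

import Mathlib

open MeasureTheory Filter Topology Set
open scoped ContDiff

noncomputable section

namespace PNP

/-- The ambient space `ℝᵈ` with its Euclidean norm. -/
abbrev E (d : ℕ) := EuclideanSpace ℝ (Fin d)

/-- `Ω` lies locally on one side of the graph of a Lipschitz function: near each boundary point,
in the direction of a unit vector `e`, it is the strict epigraph of a Lipschitz function of the
coordinates orthogonal to `e`. -/
def HasLipschitzBoundary {d : ℕ} (Ω : Set (E d)) : Prop :=
  ∀ x ∈ frontier Ω, ∃ e : E d, ‖e‖ = 1 ∧ ∃ f : E d → ℝ, (∃ K, LipschitzWith K f) ∧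
    (∀ (y : E d) (t : ℝ), f (y + t • e) = f y) ∧
    ∃ r > 0, ∀ y ∈ Metric.ball x r, (y ∈ Ω ↔ f y < inner ℝ e y)

/-- `G` is the weak gradient of `u` on `Ω`. -/
def HasWeakGradient {d : ℕ} (Ω : Set (E d)) (u : E d → ℝ) (G : E d → E d) : Prop :=
  ∀ η : E d → ℝ, ContDiff ℝ ∞ η → HasCompactSupport η → tsupport η ⊆ Ω →
    ∫ x in Ω, u x • gradient η x = -∫ x in Ω, η x • G x

theorem memLp_test {d : ℕ} (Ω : Set (E d)) {η : E d → ℝ} (h : ContDiff ℝ ∞ η)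
    (hc : HasCompactSupport η) : MemLp η 2 (volume.restrict Ω) :=
  (h.continuous.memLp_of_hasCompactSupport hc).restrict Ω

theorem memLp_gradient_test {d : ℕ} (Ω : Set (E d)) {η : E d → ℝ} (h : ContDiff ℝ ∞ η)
    (hc : HasCompactSupport η) : MemLp (gradient η) 2 (volume.restrict Ω) := by
  have h1 : Continuous (fderiv ℝ η) := h.continuous_fderiv (by simp)
  have h2 : Continuous (gradient η) :=
    (InnerProductSpace.toDual ℝ (E d)).symm.continuous.comp h1
  have h3 : HasCompactSupport (gradient η) :=
    (hc.fderiv (𝕜 := ℝ)).comp_left (g := (InnerProductSpace.toDual ℝ (E d)).symm) (map_zero _)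
  exact (h2.memLp_of_hasCompactSupport h3).restrict Ω

/-- The Sobolev space `H¹(Ω)`: pairs of a function in `L²(Ω)` and its weak gradient in `L²(Ω)`
(representatives, not classes). -/
def H1Submodule {d : ℕ} (Ω : Set (E d)) : Submodule ℝ ((E d → ℝ) × (E d → E d)) where
  carrier := {w | MemLp w.1 2 (volume.restrict Ω) ∧ MemLp w.2 2 (volume.restrict Ω) ∧
    HasWeakGradient Ω w.1 w.2}
  zero_mem' := by
    refine ⟨MemLp.zero, MemLp.zero, ?_⟩
    intro η _ _ _
    simp
  add_mem' := by
    rintro u w ⟨hu, hu', hu''⟩ ⟨hw, hw', hw''⟩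
    refine ⟨hu.add hw, hu'.add hw', ?_⟩
    intro η h hc hs
    have a := hu'' η h hc hs
    have b := hw'' η h hc hs
    have i1 : Integrable (fun x => u.1 x • gradient η x) (volume.restrict Ω) :=
      memLp_one_iff_integrable.1 ((memLp_gradient_test Ω h hc).smul hu)
    have i2 : Integrable (fun x => w.1 x • gradient η x) (volume.restrict Ω) :=
      memLp_one_iff_integrable.1 ((memLp_gradient_test Ω h hc).smul hw)
    have i3 : Integrable (fun x => η x • u.2 x) (volume.restrict Ω) :=
      memLp_one_iff_integrable.1 (hu'.smul (memLp_test Ω h hc))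
    have i4 : Integrable (fun x => η x • w.2 x) (volume.restrict Ω) :=
      memLp_one_iff_integrable.1 (hw'.smul (memLp_test Ω h hc))
    simp only [Prod.fst_add, Prod.snd_add, Pi.add_apply, add_smul, smul_add]
    rw [integral_add i1 i2, integral_add i3 i4, a, b, neg_add]
  smul_mem' := by
    rintro t u ⟨hu, hu', hu''⟩
    refine ⟨hu.const_smul t, hu'.const_smul t, ?_⟩
    intro η h hc hs
    have a := hu'' η h hc hs
    simp only [Prod.smul_fst, Prod.smul_snd, Pi.smul_apply, smul_eq_mul, mul_smul]
    simp only [smul_comm _ t, integral_smul]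
    rw [a, smul_neg]

/-- The type of elements of the Sobolev space `H¹(Ω)`. -/
abbrev H1 {d : ℕ} (Ω : Set (E d)) : Type := H1Submodule Ω

/-- The function underlying an element of `H¹(Ω)`. -/
def H1.fn {d : ℕ} {Ω : Set (E d)} (u : H1 Ω) : E d → ℝ := u.1.1

/-- The weak gradient of an element of `H¹(Ω)`. -/
def H1.grad {d : ℕ} {Ω : Set (E d)} (u : H1 Ω) : E d → E d := u.1.2

/-- The norm of `H¹(Ω)`. -/
def H1.norm {d : ℕ} {Ω : Set (E d)} (u : H1 Ω) : ℝ :=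
  Real.sqrt ((∫ x in Ω, u.fn x ^ 2) + ∫ x in Ω, ‖u.grad x‖ ^ 2)

/-- `u` belongs to `W^{1,∞}(Ω)`. -/
def H1.MemW1Inf {d : ℕ} {Ω : Set (E d)} (u : H1 Ω) : Prop :=
  MemLp u.fn ⊤ (volume.restrict Ω) ∧ MemLp u.grad ⊤ (volume.restrict Ω)

/-- The surface measure of `∂Ω`, that is, the `(d-1)`-dimensional Hausdorff measure on `∂Ω`. -/
def surfaceMeasure {d : ℕ} (Ω : Set (E d)) : Measure (E d) :=
  (Measure.hausdorffMeasure ((d : ℝ) - 1)).restrict (frontier Ω)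

/-- `h ∈ L²(∂Ω)` is the trace of `u ∈ H¹(Ω)`: smooth functions on `ℝᵈ` converge to `u` in `H¹(Ω)`
while their restrictions to `∂Ω` converge to `h` in `L²(∂Ω)`. -/
def HasTrace {d : ℕ} {Ω : Set (E d)} (u : H1 Ω) (h : E d → ℝ) : Prop :=
  MemLp h 2 (surfaceMeasure Ω) ∧ ∃ v : ℕ → E d → ℝ, (∀ n, ContDiff ℝ ∞ (v n)) ∧
    Tendsto (fun n => eLpNorm (fun x => v n x - u.fn x) 2 (volume.restrict Ω)) atTop (𝓝 0) ∧
    Tendsto (fun n => eLpNorm (fun x => gradient (v n) x - u.grad x) 2 (volume.restrict Ω))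
      atTop (𝓝 0) ∧
    Tendsto (fun n => eLpNorm (fun x => v n x - h x) 2 (surfaceMeasure Ω)) atTop (𝓝 0)

/-- `u = 0` on `Γ ⊆ ∂Ω` in the sense of traces. -/
def ZeroOn {d : ℕ} {Ω : Set (E d)} (Γ : Set (E d)) (u : H1 Ω) : Prop :=
  ∃ h, HasTrace u h ∧ ∀ᵐ x ∂(surfaceMeasure Ω), x ∈ Γ → h x = 0

/-- The valences `z₁ = 1`, `z₂ = -1`. -/
def z : Fin 2 → ℝ := ![1, -1]

/-- Material parameters: diffusion and dielectric coefficients in the electrolyte (`D₀`, `ε₀`) and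
in the electrode (`Dₘ`, `εₘ`), the repulsion strength `α₀` and the interpolation exponent `p`. -/
structure Params where
  D₀ : ℝ
  Dₘ : ℝ
  ε₀ : ℝ
  εₘ : ℝ
  α₀ : ℝ
  p : ℕ
  Dₘ_pos : 0 < Dₘ
  Dₘ_lt : Dₘ < D₀
  ε₀_pos : 0 < ε₀
  ε₀_lt : ε₀ < εₘ
  α₀_pos : 0 < α₀
  p_pos : 0 < p

/-- The diffusion function `D`. -/
def Params.D (P : Params) (a : ℝ) : ℝ := P.Dₘ + max (min (a ^ P.p) 1) 0 * (P.D₀ - P.Dₘ)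

/-- The dielectric function `ε`. -/
def Params.ε (P : Params) (a : ℝ) : ℝ := P.εₘ + max (min (a ^ P.p) 1) 0 * (P.ε₀ - P.εₘ)

/-- `∇c + z c ∇ψ - α₀ c ∇φ` for a species of valence `zi`. -/
def flux {d : ℕ} {Ω : Set (E d)} (P : Params) (zi : ℝ) (φ c ψ : H1 Ω) (x : E d) : E d :=
  c.grad x + (zi * c.fn x) • ψ.grad x - (P.α₀ * c.fn x) • φ.grad x

/-- `(c, ψ)` is a weak solution of the steady-state Poisson–Nernst–Planck system for the phase
field `φ`, with Dirichlet data `cinf`, `g` on `Γ`; all the integrals are required to exist. -/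
def IsPNPSolution {d : ℕ} {Ω : Set (E d)} (P : Params) (Γ : Set (E d)) (cinf : Fin 2 → H1 Ω)
    (g φ : H1 Ω) (c : Fin 2 → H1 Ω) (ψ : H1 Ω) : Prop :=
  (∀ i, ZeroOn Γ (c i - cinf i)) ∧ ZeroOn Γ (ψ - g) ∧
  (∀ i, ∀ s : H1 Ω, ZeroOn Γ s →
    IntegrableOn (fun x => P.D (φ.fn x) * inner ℝ (flux P (z i) φ (c i) ψ x) (s.grad x)) Ω ∧
    ∫ x in Ω, P.D (φ.fn x) * inner ℝ (flux P (z i) φ (c i) ψ x) (s.grad x) = 0) ∧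
  (∀ ζ : H1 Ω, ZeroOn Γ ζ →
    IntegrableOn (fun x => P.ε (φ.fn x) * inner ℝ (ψ.grad x) (ζ.grad x)
      - (∑ i, z i * (c i).fn x) * ζ.fn x) Ω ∧
    ∫ x in Ω, (P.ε (φ.fn x) * inner ℝ (ψ.grad x) (ζ.grad x)
      - (∑ i, z i * (c i).fn x) * ζ.fn x) = 0)

/-- `(s, ζ)` is a weak solution of the adjoint system at the phase field `φ` and the state
`(c, ψ)`; all the integrals are required to exist. -/
def IsAdjointSolution {d : ℕ} {Ω : Set (E d)} (P : Params) (Γ : Set (E d)) (φ : H1 Ω)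
    (c : Fin 2 → H1 Ω) (ψ : H1 Ω) (s : Fin 2 → H1 Ω) (ζ : H1 Ω) : Prop :=
  (∀ i, ZeroOn Γ (s i)) ∧ ZeroOn Γ ζ ∧
  (∀ i, ∀ q : H1 Ω, ZeroOn Γ q →
    IntegrableOn (fun x => P.D (φ.fn x) * inner ℝ ((s i).grad x) (flux P (z i) φ q ψ x)
      + z i * q.fn x - z i * ζ.fn x * q.fn x) Ω ∧
    ∫ x in Ω, (P.D (φ.fn x) * inner ℝ ((s i).grad x) (flux P (z i) φ q ψ x)
      + z i * q.fn x - z i * ζ.fn x * q.fn x) = 0) ∧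
  (∀ η : H1 Ω, ZeroOn Γ η →
    IntegrableOn (fun x => P.ε (φ.fn x) * inner ℝ (ζ.grad x) (η.grad x)) Ω ∧
    (∀ i, IntegrableOn (fun x => P.D (φ.fn x) * z i * (c i).fn x *
      inner ℝ ((s i).grad x) (η.grad x)) Ω) ∧
    (∫ x in Ω, P.ε (φ.fn x) * inner ℝ (ζ.grad x) (η.grad x))
      + ∑ i, ∫ x in Ω, P.D (φ.fn x) * z i * (c i).fn x *
          inner ℝ ((s i).grad x) (η.grad x) = 0)

/-- The net-charge objective `𝒥`. -/
def J {d : ℕ} {Ω : Set (E d)} (c : Fin 2 → H1 Ω) : ℝ :=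
  ∫ x in Ω, -∑ i, z i * (c i).fn x

/-- Along the phase fields `φ + tθ` (`t` close to `0` in the sense of the filter `l`),
`(c, ψ)` selects solutions of the state system, with concentrations uniformly bounded in `L^∞(Ω)`
and `‖c(φ + tθ) - c(φ)‖ + ‖ψ(φ + tθ) - ψ(φ)‖ = O(t)` in `H¹(Ω)`. -/
def RegularStateAlong {d : ℕ} {Ω : Set (E d)} (P : Params) (Γ : Set (E d))
    (cinf : Fin 2 → H1 Ω) (g : H1 Ω) (c : H1 Ω → Fin 2 → H1 Ω) (ψ : H1 Ω → H1 Ω)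
    (φ θ : H1 Ω) (l : Filter ℝ) : Prop :=
  (∀ᶠ t in l, IsPNPSolution P Γ cinf g (φ + t • θ) (c (φ + t • θ)) (ψ (φ + t • θ))) ∧
  (∃ M : ℝ, ∀ᶠ t in l, ∀ i, ∀ᵐ x ∂(volume.restrict Ω), |(c (φ + t • θ) i).fn x| ≤ M) ∧
  (∀ i, (fun t => (c (φ + t • θ) i - c φ i).norm) =O[l] fun t => t) ∧
  ((fun t => (ψ (φ + t • θ) - ψ φ).norm) =O[l] fun t => t)

/-- The one-sided directional derivative `lim_{t → 0⁺} (f (a + t b) - f a) / t`. -/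
def dirDeriv (f : ℝ → ℝ) (a b : ℝ) : ℝ := derivWithin (fun t => f (a + t * b)) (Ici 0) 0

/-- `-∑ᵢ ∫ dD (∇cᵢ + zᵢcᵢ∇ψ - α₀cᵢ∇φ)·∇sᵢ - ∫ dε ∇ψ·∇ζ + ∑ᵢ ∫ D(φ) α₀ cᵢ ∇θ·∇sᵢ`,
where `dD`, `dε` stand for `⟨D'(φ), θ⟩` and `⟨ε'(φ), θ⟩`. -/
def sensitivity {d : ℕ} {Ω : Set (E d)} (P : Params) (φ θ : H1 Ω) (dD dε : E d → ℝ)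
    (c : Fin 2 → H1 Ω) (ψ : H1 Ω) (s : Fin 2 → H1 Ω) (ζ : H1 Ω) : ℝ :=
  -(∑ i, ∫ x in Ω, dD x * inner ℝ (flux P (z i) φ (c i) ψ x) ((s i).grad x))
    - (∫ x in Ω, dε x * inner ℝ (ψ.grad x) (ζ.grad x))
    + ∑ i, ∫ x in Ω, P.D (φ.fn x) * P.α₀ * (c i).fn x * inner ℝ (θ.grad x) ((s i).grad x)

/-- All the integrals in `sensitivity` exist. -/
def SensitivityIntegrable {d : ℕ} {Ω : Set (E d)} (P : Params) (φ θ : H1 Ω) (dD dε : E d → ℝ)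
    (c : Fin 2 → H1 Ω) (ψ : H1 Ω) (s : Fin 2 → H1 Ω) (ζ : H1 Ω) : Prop :=
  (∀ i, IntegrableOn (fun x => dD x * inner ℝ (flux P (z i) φ (c i) ψ x) ((s i).grad x)) Ω) ∧
  IntegrableOn (fun x => dε x * inner ℝ (ψ.grad x) (ζ.grad x)) Ω ∧
  ∀ i, IntegrableOn (fun x => P.D (φ.fn x) * P.α₀ * (c i).fn x *
    inner ℝ (θ.grad x) ((s i).grad x)) Ω

end PNP

end

/-!
Testing the difference of the state equations with the adjoint state, and the adjoint equations with
the increment of the state, cancels all terms that are linear in the increment of the state. What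
remains is an exact formula for `𝒥(c(φ + tθ)) - 𝒥(c(φ))`, in which every term contains an increment
of `D`, `ε` or `φ`, or the product of the increments of `cᵢ` and `ψ`. It differs from `t` times the
claimed derivative by two kinds of terms, both `o(t)` in `L¹(Ω)`: difference quotients minus their
limits, by dominated convergence, since `D` and `ε` are Lipschitz; and bounded factors that tend
to `0`, multiplied by the gradient of a state increment, which is `O(t)` in `L²(Ω)`. Pointwise
convergence of the concentrations, which holds only along subsequences, suffices for this.
-/

noncomputable section

namespace PNP

open scoped NNReal InnerProductSpace

section MaterialLaws

theorem differentiableWithinAt_Ici_abs {h : ℝ → ℝ} {a : ℝ}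
    (hh : DifferentiableWithinAt ℝ h (Ici a) a) :
    DifferentiableWithinAt ℝ (fun t => |h t|) (Ici a) a := by
  by_cases ha : h a = 0
  · have hslope := hh.hasDerivWithinAt.Ioi_of_Ici
    rw [hasDerivWithinAt_iff_tendsto_slope' self_notMem_Ioi] at hslope
    refine (HasDerivWithinAt.Ici_of_Ioi
      (f' := |derivWithin h (Ici a) a|) ?_).differentiableWithinAt
    rw [hasDerivWithinAt_iff_tendsto_slope' self_notMem_Ioi]
    refine hslope.abs.congr' ?_
    filter_upwards [self_mem_nhdsWithin] with t ht
    rw [slope_def_field, slope_def_field, ha, abs_zero, sub_zero, sub_zero, abs_div,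
      abs_of_pos (sub_pos.2 ht)]
  · exact hh.abs ha

theorem differentiableWithinAt_Ici_max {f g : ℝ → ℝ} {a : ℝ}
    (hf : DifferentiableWithinAt ℝ f (Ici a) a) (hg : DifferentiableWithinAt ℝ g (Ici a) a) :
    DifferentiableWithinAt ℝ (fun t => max (f t) (g t)) (Ici a) a := by
  simp only [sup_eq_half_smul_add_add_abs_sub' ℝ]
  exact ((hf.add hg).add (differentiableWithinAt_Ici_abs (hg.sub hf))).const_smul (2⁻¹ : ℝ)

theorem differentiableWithinAt_Ici_min {f g : ℝ → ℝ} {a : ℝ}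
    (hf : DifferentiableWithinAt ℝ f (Ici a) a) (hg : DifferentiableWithinAt ℝ g (Ici a) a) :
    DifferentiableWithinAt ℝ (fun t => min (f t) (g t)) (Ici a) a := by
  simp only [inf_eq_half_smul_add_sub_abs_sub' ℝ]
  exact ((hf.add hg).sub (differentiableWithinAt_Ici_abs (hg.sub hf))).const_smul (2⁻¹ : ℝ)

/-- The power `a ^ p` truncated to `[0, 1]`, through which the phase field enters the diffusion and
the dielectric function. -/
def truncPow (p : ℕ) (a : ℝ) : ℝ := max (min (a ^ p) 1) 0

theorem truncPow_nonneg (p : ℕ) (a : ℝ) : 0 ≤ truncPow p a := le_max_right _ _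

theorem truncPow_le_one (p : ℕ) (a : ℝ) : truncPow p a ≤ 1 :=
  max_le (min_le_right _ _) zero_le_one

theorem truncPow_clamp (p : ℕ) (a : ℝ) : truncPow p (max (min a 1) (-1)) = truncPow p a := by
  rcases le_total 1 a with h1 | h1
  · rw [min_eq_right h1, max_eq_left (by norm_num), truncPow, truncPow, one_pow, min_self,
      min_eq_right (one_le_pow₀ h1)]
  rcases le_total (-1) a with h2 | h2
  · rw [min_eq_left h1, max_eq_left h2]
  have hpow : 1 ≤ (-a) ^ p := one_le_pow₀ (by linarith)
  rw [min_eq_left h1, max_eq_right h2, truncPow, truncPow]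
  rcases p.even_or_odd with hp | hp
  · rw [hp.neg_pow] at hpow
    rw [hp.neg_one_pow, min_self, min_eq_right hpow]
  · rw [hp.neg_pow] at hpow
    rw [hp.neg_one_pow, max_eq_right ((min_le_left _ _).trans (by norm_num)),
      max_eq_right ((min_le_left _ _).trans (by linarith))]

theorem lipschitzOnWith_pow_Icc (p : ℕ) :
    LipschitzOnWith p (fun a : ℝ => a ^ p) (Icc (-1) 1) := by
  refine LipschitzOnWith.of_dist_le_mul fun x hx y hy => ?_
  have hmax : max |x| |y| ≤ 1 := max_le (abs_le.2 hx) (abs_le.2 hy)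
  calc |x ^ p - y ^ p| ≤ |x - y| * p * max |x| |y| ^ (p - 1) := abs_pow_sub_pow_le x y p
    _ ≤ |x - y| * p * 1 := by
        gcongr
        exact pow_le_one₀ ((abs_nonneg x).trans (le_max_left _ _)) hmax
    _ = p * |x - y| := by ring

theorem lipschitzWith_truncPow (p : ℕ) : LipschitzWith p (truncPow p) := by
  have clamp_arg : LipschitzWith 1 fun a : ℝ => max (min a 1) (-1) :=
    (LipschitzWith.id.min_const 1).max_const (-1)
  have clamp_val : LipschitzWith 1 fun a : ℝ => max (min a 1) 0 :=
    (LipschitzWith.id.min_const 1).max_const 0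
  have h := clamp_val.comp_lipschitzOnWith ((lipschitzOnWith_pow_Icc p).comp
    (clamp_arg.lipschitzOnWith (s := univ)) fun a _ =>
      ⟨le_max_right _ _, max_le (min_le_right _ _) (by norm_num)⟩)
  rw [lipschitzOnWith_univ, one_mul, mul_one] at h
  exact funext (truncPow_clamp p) ▸ h

theorem differentiableWithinAt_truncPow_line (p : ℕ) (a b : ℝ) :
    DifferentiableWithinAt ℝ (fun t => truncPow p (a + t * b)) (Ici 0) 0 :=
  differentiableWithinAt_Ici_max
    (differentiableWithinAt_Ici_min (by fun_prop) (differentiableWithinAt_const (c := 1)))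
    (differentiableWithinAt_const (c := 0))

/-- The regularity of a material coefficient (such as `Params.D` and `Params.ε`) that the
sensitivity analysis uses: it is bounded by `M`, Lipschitz with constant `L`, and has one-sided
directional derivatives everywhere. -/
structure IsMaterialLaw (f : ℝ → ℝ) (M : ℝ) (L : ℝ≥0) : Prop where
  abs_le : ∀ a, |f a| ≤ M
  lipschitz : LipschitzWith L f
  differentiableWithinAt_line : ∀ a b,
    DifferentiableWithinAt ℝ (fun t => f (a + t * b)) (Ici 0) 0

theorem isMaterialLaw_add_truncPow_mul (p : ℕ) (A B : ℝ) :
    IsMaterialLaw (fun a => A + truncPow p a * B) (|A| + |B|) (p * ‖B‖₊) where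
  abs_le a := calc
    |A + truncPow p a * B| ≤ |A| + truncPow p a * |B| := by
        simpa only [abs_mul, abs_of_nonneg (truncPow_nonneg p a)] using
          abs_add_le A (truncPow p a * B)
    _ ≤ |A| + |B| := by
        gcongr
        exact mul_le_of_le_one_left (abs_nonneg B) (truncPow_le_one p a)
  lipschitz := LipschitzWith.of_dist_le_mul fun x y => by
    have h := mul_le_mul_of_nonneg_right ((lipschitzWith_truncPow p).dist_le_mul x y) (abs_nonneg B)
    rw [Real.dist_eq, ← abs_mul] at h
    rw [Real.dist_eq, add_sub_add_left_eq_sub, ← sub_mul]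
    exact h.trans_eq (by simp only [NNReal.coe_mul, coe_nnnorm, Real.norm_eq_abs]; ring)
  differentiableWithinAt_line a b := (differentiableWithinAt_const A).add
    ((differentiableWithinAt_truncPow_line p a b).mul (differentiableWithinAt_const B))

theorem Params.exists_isMaterialLaw_D (P : Params) : ∃ M L, IsMaterialLaw P.D M L :=
  ⟨_, _, isMaterialLaw_add_truncPow_mul P.p P.Dₘ (P.D₀ - P.Dₘ)⟩

theorem Params.exists_isMaterialLaw_ε (P : Params) : ∃ M L, IsMaterialLaw P.ε M L :=
  ⟨_, _, isMaterialLaw_add_truncPow_mul P.p P.εₘ (P.ε₀ - P.εₘ)⟩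

theorem hasDerivAt_line {f : ℝ → ℝ} {a b : ℝ} (h : b = 0 ∨ DifferentiableAt ℝ f a) :
    HasDerivAt (fun t => f (a + t * b)) (deriv f a * b) 0 := by
  rcases h with rfl | h
  · simpa using hasDerivAt_const (0 : ℝ) (f a)
  · have hline : HasDerivAt (fun t : ℝ => a + t * b) b 0 := by
      simpa using ((hasDerivAt_id (0 : ℝ)).mul_const b).const_add a
    have hf : HasDerivAt f (deriv f a) (a + 0 * b) := by simpa using h.hasDerivAt
    exact hf.comp 0 hline

theorem dirDeriv_eq_deriv_mul {f : ℝ → ℝ} {a b : ℝ} (h : b = 0 ∨ DifferentiableAt ℝ f a) :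
    dirDeriv f a b = deriv f a * b :=
  (hasDerivAt_line h).hasDerivWithinAt.derivWithin (uniqueDiffWithinAt_Ici 0)

namespace IsMaterialLaw

variable {f : ℝ → ℝ} {M : ℝ} {L : ℝ≥0}

theorem hasDerivWithinAt_line (hf : IsMaterialLaw f M L) (a b : ℝ) :
    HasDerivWithinAt (fun t => f (a + t * b)) (dirDeriv f a b) (Ici 0) 0 :=
  (hf.differentiableWithinAt_line a b).hasDerivWithinAt

theorem abs_sub_le (hf : IsMaterialLaw f M L) (a b t : ℝ) :
    |f (a + t * b) - f a| ≤ L * (|t| * |b|) := by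
  simpa [Real.dist_eq, abs_mul] using hf.lipschitz.dist_le_mul (a + t * b) a

theorem tendsto_quotient (hf : IsMaterialLaw f M L) (a b : ℝ) :
    Tendsto (fun t => t⁻¹ * (f (a + t * b) - f a)) (𝓝[>] 0) (𝓝 (dirDeriv f a b)) := by
  have h := (hf.hasDerivWithinAt_line a b).Ioi_of_Ici
  rw [hasDerivWithinAt_iff_tendsto_slope' self_notMem_Ioi] at h
  simpa [slope_fun_def] using h

theorem abs_dirDeriv_le (hf : IsMaterialLaw f M L) (a b : ℝ) : |dirDeriv f a b| ≤ L * |b| := by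
  refine le_of_tendsto (hf.tendsto_quotient a b).abs ?_
  filter_upwards [self_mem_nhdsWithin] with t (ht : 0 < t)
  rw [abs_mul, abs_inv, inv_mul_le_iff₀ (abs_pos.2 ht.ne')]
  exact (hf.abs_sub_le a b t).trans_eq (mul_left_comm _ _ _)

theorem measurable_dirDeriv (hf : IsMaterialLaw f M L) :
    Measurable fun p : ℝ × ℝ => dirDeriv f p.1 p.2 := by
  have hcont := hf.lipschitz.continuous
  exact measurable_of_tendsto_metrizable' (𝓝[>] (0 : ℝ))
    (f := fun t p => t⁻¹ * (f (p.1 + t * p.2) - f p.1))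
    (fun t => Continuous.measurable (by fun_prop))
    (tendsto_pi_nhds.2 fun p => hf.tendsto_quotient p.1 p.2)

theorem tendsto_line (hf : IsMaterialLaw f M L) (a b : ℝ) :
    Tendsto (fun t => f (a + t * b)) (𝓝 0) (𝓝 (f a)) := by
  have hcont := hf.lipschitz.continuous
  simpa using (show Continuous fun t => f (a + t * b) by fun_prop).tendsto 0

end IsMaterialLaw

end MaterialLaws

section Integration

open Asymptotics

variable {ι α : Type*} [MeasurableSpace α] {μ : Measure α} {l : Filter ι} {r : ι → ℝ}
  {V : Type*} [NormedAddCommGroup V]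

/-- `f` is integrable with integral `a`. Unlike the bare equation `∫ x, f x ∂μ = a`, it can be added
up without further integrability conditions. -/
def HasIntegral (f : α → ℝ) (a : ℝ) (μ : Measure α) : Prop :=
  Integrable f μ ∧ ∫ x, f x ∂μ = a

namespace HasIntegral

variable {f g : α → ℝ} {a b : ℝ}

theorem add (hf : HasIntegral f a μ) (hg : HasIntegral g b μ) :
    HasIntegral (fun x => f x + g x) (a + b) μ :=
  ⟨hf.1.add hg.1, by rw [integral_add hf.1 hg.1, hf.2, hg.2]⟩

theorem sub (hf : HasIntegral f a μ) (hg : HasIntegral g b μ) :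
    HasIntegral (fun x => f x - g x) (a - b) μ :=
  ⟨hf.1.sub hg.1, by rw [integral_sub hf.1 hg.1, hf.2, hg.2]⟩

theorem const_mul (k : ℝ) (hf : HasIntegral f a μ) : HasIntegral (fun x => k * f x) (k * a) μ :=
  ⟨hf.1.const_mul k, by rw [integral_const_mul, hf.2]⟩

theorem sum {κ : Type*} [Fintype κ] {f : κ → α → ℝ} {a : κ → ℝ}
    (hf : ∀ i, HasIntegral (f i) (a i) μ) : HasIntegral (fun x => ∑ i, f i x) (∑ i, a i) μ :=
  ⟨integrable_finsetSum _ fun i _ => (hf i).1, by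
    simp only [integral_finsetSum _ fun i _ => (hf i).1, (hf _).2]⟩

end HasIntegral

/-- `F t = o(r t)` in `L¹(μ)` along the filter `l`. Integrability is part of the notion since the
Bochner integral of a non-integrable function is `0`. -/
structure IsLittleOL1 (μ : Measure α) (l : Filter ι) (F : ι → α → V) (r : ι → ℝ) : Prop where
  eventually_integrable : ∀ᶠ t in l, Integrable (F t) μ
  isLittleO : (fun t => ∫ x, ‖F t x‖ ∂μ) =o[l] r

namespace IsLittleOL1

variable {F G : ι → α → V}

theorem add (hF : IsLittleOL1 μ l F r) (hG : IsLittleOL1 μ l G r) :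
    IsLittleOL1 μ l (fun t x => F t x + G t x) r where
  eventually_integrable := by
    filter_upwards [hF.eventually_integrable, hG.eventually_integrable] with t hFt hGt
      using hFt.add hGt
  isLittleO := by
    refine (IsBigO.of_bound' ?_).trans_isLittleO (hF.isLittleO.add hG.isLittleO)
    filter_upwards [hF.eventually_integrable, hG.eventually_integrable] with t hFt hGt
    rw [Real.norm_of_nonneg (integral_nonneg fun _ => norm_nonneg _),
      ← integral_add hFt.norm hGt.norm]
    exact (integral_mono (hFt.add hGt).norm (hFt.norm.add hGt.norm)
      fun x => norm_add_le _ _).trans (le_abs_self _)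

theorem const_smul [NormedSpace ℝ V] (k : ℝ) (hF : IsLittleOL1 μ l F r) :
    IsLittleOL1 μ l (fun t x => k • F t x) r where
  eventually_integrable := hF.eventually_integrable.mono fun t hFt => hFt.smul k
  isLittleO := by
    simpa only [norm_smul, integral_const_mul] using hF.isLittleO.const_mul_left ‖k‖

theorem sub [NormedSpace ℝ V] (hF : IsLittleOL1 μ l F r) (hG : IsLittleOL1 μ l G r) :
    IsLittleOL1 μ l (fun t x => F t x - G t x) r := by
  simpa only [neg_one_smul, ← sub_eq_add_neg] using hF.add (hG.const_smul (-1))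

theorem isLittleO_integral [NormedSpace ℝ V] (hF : IsLittleOL1 μ l F r) :
    (fun t => ∫ x, F t x ∂μ) =o[l] r :=
  (IsBigO.of_bound' (Eventually.of_forall fun _ =>
    (norm_integral_le_integral_norm _).trans (le_abs_self _))).trans_isLittleO hF.isLittleO

theorem of_dominated [l.IsCountablyGenerated] {g : α → ℝ}
    (hF : ∀ᶠ t in l, AEStronglyMeasurable (F t) μ) (hg : Integrable g μ)
    (hbound : ∀ᶠ t in l, ∀ᵐ x ∂μ, ‖F t x‖ ≤ |r t| * g x)
    (hlim : ∀ᵐ x ∂μ, (fun t => F t x) =o[l] r) : IsLittleOL1 μ l F r where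
  eventually_integrable := by
    filter_upwards [hF, hbound] with t hFt hbt using (hg.const_mul |r t|).mono' hFt hbt
  isLittleO := by
    refine (isLittleO_iff_tendsto' ?_).2 ?_
    · filter_upwards [hbound] with t hbt hrt
      refine integral_eq_zero_of_ae ?_
      filter_upwards [hbt] with x hx
      exact le_antisymm (by simpa [hrt] using hx) (norm_nonneg _)
    · simp only [← integral_div]
      rw [← integral_zero α ℝ (μ := μ)]
      refine tendsto_integral_filter_of_dominated_convergence (fun x => |g x|)
        (hF.mono fun t hFt => hFt.norm.mul_const _) ?_ hg.abs ?_
      · filter_upwards [hbound] with t hbt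
        filter_upwards [hbt] with x hx
        rw [norm_div, norm_norm]
        refine div_le_of_le_mul₀ (norm_nonneg _) (abs_nonneg _) (hx.trans ?_)
        rw [mul_comm, Real.norm_eq_abs]
        gcongr
        exact le_abs_self _
      · filter_upwards [hlim] with x hx using hx.norm_left.tendsto_div_nhds_zero

end IsLittleOL1

/-- A family of measurable functions that converges almost everywhere and is bounded uniformly, as
in the bounded convergence theorem. -/
structure BoundedlyTendstoAE (μ : Measure α) (v : ι → α → ℝ) (l : Filter ι) (v₀ : α → ℝ) :
    Prop where
  aestronglyMeasurable : ∀ t, AEStronglyMeasurable (v t) μ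
  aestronglyMeasurable_lim : AEStronglyMeasurable v₀ μ
  exists_bound : ∃ M, (∀ᶠ t in l, ∀ᵐ x ∂μ, |v t x| ≤ M) ∧ ∀ᵐ x ∂μ, |v₀ x| ≤ M
  ae_tendsto : ∀ᵐ x ∂μ, Tendsto (fun t => v t x) l (𝓝 (v₀ x))

namespace BoundedlyTendstoAE

variable {u v : ι → α → ℝ} {u₀ v₀ : α → ℝ}

theorem const (k : ℝ) : BoundedlyTendstoAE μ (fun (_ : ι) _ => k) l fun _ => k where
  aestronglyMeasurable _ := aestronglyMeasurable_const
  aestronglyMeasurable_lim := aestronglyMeasurable_const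
  exists_bound := ⟨|k|, by simp⟩
  ae_tendsto := Eventually.of_forall fun _ => tendsto_const_nhds

theorem mul (hu : BoundedlyTendstoAE μ u l u₀) (hv : BoundedlyTendstoAE μ v l v₀) :
    BoundedlyTendstoAE μ (fun t x => u t x * v t x) l fun x => u₀ x * v₀ x where
  aestronglyMeasurable t := (hu.aestronglyMeasurable t).mul (hv.aestronglyMeasurable t)
  aestronglyMeasurable_lim := hu.aestronglyMeasurable_lim.mul hv.aestronglyMeasurable_lim
  exists_bound := by
    obtain ⟨M, hM, hM₀⟩ := hu.exists_bound
    obtain ⟨N, hN, hN₀⟩ := hv.exists_bound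
    have abs_mul_le {a b : ℝ} (ha : |a| ≤ M) (hb : |b| ≤ N) : |a * b| ≤ M * N := by
      rw [abs_mul]
      exact mul_le_mul ha hb (abs_nonneg _) ((abs_nonneg _).trans ha)
    refine ⟨M * N, ?_, ?_⟩
    · filter_upwards [hM, hN] with t hMt hNt
      filter_upwards [hMt, hNt] with x hMx hNx using abs_mul_le hMx hNx
    · filter_upwards [hM₀, hN₀] with x hMx hNx using abs_mul_le hMx hNx
  ae_tendsto := by
    filter_upwards [hu.ae_tendsto, hv.ae_tendsto] with x hux hvx using hux.mul hvx

theorem sub_limit (hv : BoundedlyTendstoAE μ v l v₀) :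
    BoundedlyTendstoAE μ (fun t x => v t x - v₀ x) l fun _ => 0 where
  aestronglyMeasurable t := (hv.aestronglyMeasurable t).sub hv.aestronglyMeasurable_lim
  aestronglyMeasurable_lim := aestronglyMeasurable_const
  exists_bound := by
    obtain ⟨M, hM, hM₀⟩ := hv.exists_bound
    refine ⟨M + M, ?_, ?_⟩
    · filter_upwards [hM] with t hMt
      filter_upwards [hMt, hM₀] with x hx hx₀ using (abs_sub _ _).trans (add_le_add hx hx₀)
    · filter_upwards [hM₀] with x hx₀
      rw [abs_zero]
      linarith [abs_nonneg (v₀ x)]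
  ae_tendsto := by
    filter_upwards [hv.ae_tendsto] with x hx using tendsto_sub_nhds_zero_iff.2 hx

theorem isLittleOL1_mul [l.IsCountablyGenerated] (hu : BoundedlyTendstoAE μ u l fun _ => 0)
    {h : α → ℝ} (hh : Integrable h μ) :
    IsLittleOL1 μ l (fun t x => r t * (u t x * h x)) r := by
  obtain ⟨M, hM, -⟩ := hu.exists_bound
  refine .of_dominated (g := fun x => M * |h x|) (Eventually.of_forall fun t =>
    ((hu.aestronglyMeasurable t).mul hh.1).const_mul (r t)) (hh.abs.const_mul M) ?_ ?_
  · filter_upwards [hM] with t hMt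
    filter_upwards [hMt] with x hx
    rw [norm_mul, norm_mul, Real.norm_eq_abs, Real.norm_eq_abs, Real.norm_eq_abs]
    gcongr
  · filter_upwards [hu.ae_tendsto] with x hx
    have huh : (fun t => u t x * h x) =o[l] fun _ => (1 : ℝ) :=
      (isLittleO_one_iff ℝ).2 (by simpa using hx.mul_const (h x))
    simpa using (isBigO_refl r l).mul_isLittleO huh

variable {W : Type*} [NormedAddCommGroup W] [InnerProductSpace ℝ W]

theorem tendsto_integral_norm_smul_sq [l.IsCountablyGenerated]
    (hu : BoundedlyTendstoAE μ u l fun _ => 0) {H : α → W} (hH : MemLp H 2 μ) :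
    Tendsto (fun t => ∫ x, ‖u t x • H x‖ ^ 2 ∂μ) l (𝓝 0) := by
  obtain ⟨M, hM, -⟩ := hu.exists_bound
  rw [← integral_zero α ℝ (μ := μ)]
  refine tendsto_integral_filter_of_dominated_convergence (fun x => M ^ 2 * ‖H x‖ ^ 2)
    (Eventually.of_forall fun t => ((hu.aestronglyMeasurable t).smul hH.1).norm.pow 2) ?_
    (hH.norm.integrable_sq.const_mul _) ?_
  · filter_upwards [hM] with t hMt
    filter_upwards [hMt] with x hx
    rw [norm_pow, norm_norm, norm_smul, mul_pow, Real.norm_eq_abs]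
    gcongr
  · filter_upwards [hu.ae_tendsto] with x hx
    simpa using (hx.smul_const (H x)).norm.pow 2

end BoundedlyTendstoAE

section Inner

variable {W : Type*} [NormedAddCommGroup W] [InnerProductSpace ℝ W]

theorem integrable_inner_of_memLp_two {G H : α → W} (hG : MemLp G 2 μ) (hH : MemLp H 2 μ) :
    Integrable (fun x => ⟪G x, H x⟫_ℝ) μ :=
  (hG.norm.integrable_mul hH.norm).mono' (hG.1.inner hH.1)
    (Eventually.of_forall fun x => norm_inner_le_norm (G x) (H x))

theorem integral_norm_inner_le {G H : α → W} (hG : MemLp G 2 μ) (hH : MemLp H 2 μ) :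
    ∫ x, ‖⟪G x, H x⟫_ℝ‖ ∂μ ≤ √(∫ x, ‖G x‖ ^ 2 ∂μ) * √(∫ x, ‖H x‖ ^ 2 ∂μ) := calc
  ∫ x, ‖⟪G x, H x⟫_ℝ‖ ∂μ ≤ ∫ x, ‖G x‖ * ‖H x‖ ∂μ :=
    integral_mono (integrable_inner_of_memLp_two hG hH).norm (hG.norm.integrable_mul hH.norm)
      fun x => norm_inner_le_norm (G x) (H x)
  _ ≤ √(∫ x, ‖G x‖ ^ 2 ∂μ) * √(∫ x, ‖H x‖ ^ 2 ∂μ) := by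
    have holder := integral_mul_le_Lp_mul_Lq_of_nonneg Real.HolderConjugate.two_two
      (Eventually.of_forall fun x => norm_nonneg (G x))
      (Eventually.of_forall fun x => norm_nonneg (H x))
      (by simpa using hG.norm) (by simpa using hH.norm)
    simpa only [Real.rpow_two, ← Real.sqrt_eq_rpow] using holder

theorem BoundedlyTendstoAE.isLittleOL1_mul_inner [l.IsCountablyGenerated] {u : ι → α → ℝ}
    {G : ι → α → W} {H : α → W} (hu : BoundedlyTendstoAE μ u l fun _ => 0)
    (hG : ∀ t, MemLp (G t) 2 μ) (hGr : (fun t => √(∫ x, ‖G t x‖ ^ 2 ∂μ)) =O[l] r)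
    (hH : MemLp H 2 μ) : IsLittleOL1 μ l (fun t x => u t x * ⟪G t x, H x⟫_ℝ) r := by
  obtain ⟨M, hM, -⟩ := hu.exists_bound
  have huH : ∀ᶠ t in l, MemLp (fun x => u t x • H x) 2 μ := hM.mono fun t hMt =>
    hH.smul (memLp_top_of_bound (hu.aestronglyMeasurable t) M hMt)
  simp only [← real_inner_smul_right]
  refine ⟨huH.mono fun t ht => integrable_inner_of_memLp_two (hG t) ht, ?_⟩
  have hsmall : (fun t => √(∫ x, ‖u t x • H x‖ ^ 2 ∂μ)) =o[l] fun _ => (1 : ℝ) :=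
    (isLittleO_one_iff ℝ).2 (by simpa using (hu.tendsto_integral_norm_smul_sq hH).sqrt)
  have hprod := hGr.mul_isLittleO hsmall
  simp only [mul_one] at hprod
  refine (IsBigO.of_bound' ?_).trans_isLittleO hprod
  filter_upwards [huH] with t ht
  rw [Real.norm_of_nonneg (integral_nonneg fun _ => norm_nonneg _)]
  exact (integral_norm_inner_le (hG t) ht).trans (le_abs_self _)

end Inner

section Subsequences

variable {X : Type*} [PseudoEMetricSpace X] {v : ι → α → X} {v₀ : α → X}

-- If `p` fails frequently along `l`, it fails along a sequence on which `v` converges a.e.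
theorem eventually_of_tendstoInMeasure [l.IsCountablyGenerated] {p : ι → Prop}
    (hv : TendstoInMeasure μ v l v₀)
    (h : ∀ l' ≤ l, l'.IsCountablyGenerated →
      (∀ᵐ x ∂μ, Tendsto (fun t => v t x) l' (𝓝 (v₀ x))) → ∀ᶠ t in l', p t) :
    ∀ᶠ t in l, p t := by
  by_contra hp
  have : (l ⊓ 𝓟 {t | ¬p t}).NeBot := frequently_iff_neBot.1 (not_eventually.1 hp)
  have hv' : TendstoInMeasure μ v (l ⊓ 𝓟 {t | ¬p t}) v₀ :=
    hv.comp (tendsto_id.mono_left inf_le_left)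
  obtain ⟨ns, hns, hae⟩ := hv'.exists_seq_tendsto_ae'
  obtain ⟨hnsl, hnp⟩ := tendsto_inf.1 hns
  have hpns : ∀ᶠ n in atTop, p (ns n) := eventually_map.1 (h (map ns atTop) hnsl inferInstance hae)
  obtain ⟨n, hn, hn'⟩ := (hpns.and (tendsto_principal.1 hnp)).exists
  exact hn' hn

theorem IsLittleOL1.of_tendstoInMeasure [l.IsCountablyGenerated] {F : ι → α → V}
    (hv : TendstoInMeasure μ v l v₀)
    (h : ∀ l' ≤ l, l'.IsCountablyGenerated →
      (∀ᵐ x ∂μ, Tendsto (fun t => v t x) l' (𝓝 (v₀ x))) → IsLittleOL1 μ l' F r) :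
    IsLittleOL1 μ l F r where
  eventually_integrable := eventually_of_tendstoInMeasure hv fun l' hl' hcg hae =>
    (h l' hl' hcg hae).eventually_integrable
  isLittleO := isLittleO_iff.2 fun _ hε => eventually_of_tendstoInMeasure hv
    fun l' hl' hcg hae => isLittleO_iff.1 (h l' hl' hcg hae).isLittleO hε

end Subsequences

namespace IsMaterialLaw

variable {f : ℝ → ℝ} {M : ℝ} {L : ℝ≥0} {φ θ : α → ℝ} {l : Filter ℝ}

theorem aestronglyMeasurable_dirDeriv (hf : IsMaterialLaw f M L) (hφ : AEStronglyMeasurable φ μ)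
    (hθ : AEStronglyMeasurable θ μ) :
    AEStronglyMeasurable (fun x => dirDeriv f (φ x) (θ x)) μ :=
  (hf.measurable_dirDeriv.comp_aemeasurable
    (hφ.aemeasurable.prodMk hθ.aemeasurable)).aestronglyMeasurable

theorem boundedlyTendstoAE (hf : IsMaterialLaw f M L) (hφ : AEStronglyMeasurable φ μ)
    (hθ : AEStronglyMeasurable θ μ) (hl : l ≤ 𝓝 0) :
    BoundedlyTendstoAE μ (fun t x => f (φ x + t * θ x)) l fun x => f (φ x) where
  aestronglyMeasurable t :=
    hf.lipschitz.continuous.comp_aestronglyMeasurable (hφ.add (hθ.const_mul t))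
  aestronglyMeasurable_lim := hf.lipschitz.continuous.comp_aestronglyMeasurable hφ
  exists_bound := ⟨M, Eventually.of_forall fun _ => Eventually.of_forall fun _ => hf.abs_le _,
    Eventually.of_forall fun _ => hf.abs_le _⟩
  ae_tendsto := Eventually.of_forall fun x => (hf.tendsto_line (φ x) (θ x)).mono_left hl

theorem integrable_dirDeriv_mul (hf : IsMaterialLaw f M L) (hφ : AEStronglyMeasurable φ μ)
    (hθ : AEStronglyMeasurable θ μ) {h : α → ℝ} (hh : AEStronglyMeasurable h μ)
    (hθh : Integrable (fun x => θ x * h x) μ) :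
    Integrable (fun x => dirDeriv f (φ x) (θ x) * h x) μ := by
  refine (hθh.abs.const_mul (L : ℝ)).mono' ((hf.aestronglyMeasurable_dirDeriv hφ hθ).mul hh)
    (Eventually.of_forall fun x => ?_)
  rw [norm_mul, abs_mul, ← mul_assoc]
  exact mul_le_mul_of_nonneg_right (hf.abs_dirDeriv_le _ _) (abs_nonneg _)

theorem isLittleO_increment_mul {S : Set ℝ} {a b : ℝ}
    (hderiv : HasDerivWithinAt (fun t => f (a + t * b)) (dirDeriv f a b) S 0) (hl : l ≤ 𝓝[S] 0)
    {w : ℝ → ℝ} {w₀ : ℝ} (hw : Tendsto w l (𝓝 w₀)) (k : ℝ) :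
    (fun t => ((f (a + t * b) - f a) * w t - t * (dirDeriv f a b * w₀)) * k) =o[l]
      fun t => t := by
  have hfirst : (fun t => f (a + t * b) - f a - t * dirDeriv f a b) =o[l] fun t => t := by
    simpa using (hasDerivWithinAt_iff_isLittleO.1 hderiv).mono hl
  have hw' : (fun t => dirDeriv f a b * (w t - w₀)) =o[l] fun _ => (1 : ℝ) :=
    (isLittleO_one_iff ℝ).2 (by simpa using (tendsto_sub_nhds_zero_iff.2 hw).const_mul _)
  have hsum := (hfirst.mul_isBigO (hw.isBigO_one ℝ)).add
    ((isBigO_refl (fun t : ℝ => t) l).mul_isLittleO hw')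
  simp only [mul_one] at hsum
  refine (hsum.const_mul_left k).congr_left fun t => ?_
  ring

theorem abs_increment_mul_le (hf : IsMaterialLaw f M L) {a b w w₀ N : ℝ} (hw : |w| ≤ N)
    (hw₀ : |w₀| ≤ N) (t k : ℝ) :
    |((f (a + t * b) - f a) * w - t * (dirDeriv f a b * w₀)) * k| ≤
      |t| * (2 * L * N * |b * k|) := calc
  _ ≤ (|f (a + t * b) - f a| * |w| + |t| * (|dirDeriv f a b| * |w₀|)) * |k| := by
      rw [abs_mul]
      gcongr
      exact (abs_sub _ _).trans_eq (by simp only [abs_mul])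
  _ ≤ (L * (|t| * |b|) * N + |t| * (L * |b| * N)) * |k| := by
      gcongr
      · exact hf.abs_sub_le a b t
      · exact hf.abs_dirDeriv_le a b
  _ = |t| * (2 * L * N * |b * k|) := by
      rw [abs_mul]
      ring

theorem isLittleOL1_increment_mul (hf : IsMaterialLaw f M L) (hφ : AEStronglyMeasurable φ μ)
    (hθ : AEStronglyMeasurable θ μ) {S : Set ℝ} [l.IsCountablyGenerated] (hl : l ≤ 𝓝[S] 0)
    (hderiv : ∀ᵐ x ∂μ, HasDerivWithinAt (fun t => f (φ x + t * θ x))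
      (dirDeriv f (φ x) (θ x)) S 0)
    {v : ℝ → α → ℝ} {v₀ : α → ℝ} (hv : BoundedlyTendstoAE μ v l v₀) {h : α → ℝ}
    (hh : AEStronglyMeasurable h μ) (hθh : Integrable (fun x => θ x * h x) μ) :
    IsLittleOL1 μ l (fun t x => ((f (φ x + t * θ x) - f (φ x)) * v t x
      - t * (dirDeriv f (φ x) (θ x) * v₀ x)) * h x) fun t => t := by
  have hfφ := hf.boundedlyTendstoAE hφ hθ (hl.trans nhdsWithin_le_nhds)
  obtain ⟨N, hN, hN₀⟩ := hv.exists_bound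
  refine .of_dominated (g := fun x => 2 * L * N * |θ x * h x|) (Eventually.of_forall fun t => ?_)
    (hθh.abs.const_mul _) ?_ ?_
  · exact (((hfφ.sub_limit.aestronglyMeasurable t).mul (hv.aestronglyMeasurable t)).sub
      (((hf.aestronglyMeasurable_dirDeriv hφ hθ).mul hv.aestronglyMeasurable_lim).const_mul t)).mul
        hh
  · filter_upwards [hN] with t hNt
    filter_upwards [hNt, hN₀] with x hx hx₀ using hf.abs_increment_mul_le hx hx₀ t (h x)
  · filter_upwards [hderiv, hv.ae_tendsto] with x hx hvx
      using isLittleO_increment_mul hx hl hvx (h x)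

end IsMaterialLaw

end Integration

section Sobolev

open Asymptotics

variable {d : ℕ} {Ω Γ : Set (E d)} {ι : Type*} {l : Filter ι}

namespace H1

theorem memLp_fn (u : H1 Ω) : MemLp u.fn 2 (volume.restrict Ω) := u.2.1

theorem memLp_grad (u : H1 Ω) : MemLp u.grad 2 (volume.restrict Ω) := u.2.2.1

@[simp] theorem fn_add (u v : H1 Ω) (x : E d) : (u + v).fn x = u.fn x + v.fn x := rfl

@[simp] theorem fn_sub (u v : H1 Ω) (x : E d) : (u - v).fn x = u.fn x - v.fn x := rfl

@[simp] theorem fn_smul (t : ℝ) (u : H1 Ω) (x : E d) : (t • u).fn x = t * u.fn x := rfl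

@[simp] theorem grad_add (u v : H1 Ω) (x : E d) : (u + v).grad x = u.grad x + v.grad x := rfl

@[simp] theorem grad_sub (u v : H1 Ω) (x : E d) : (u - v).grad x = u.grad x - v.grad x := rfl

@[simp] theorem grad_smul (t : ℝ) (u : H1 Ω) (x : E d) : (t • u).grad x = t • u.grad x := rfl

theorem sqrt_integral_norm_grad_sq_le_norm (u : H1 Ω) :
    √(∫ x in Ω, ‖u.grad x‖ ^ 2) ≤ u.norm :=
  Real.sqrt_le_sqrt (le_add_of_nonneg_left (integral_nonneg fun _ => sq_nonneg _))

theorem isBigO_sqrt_integral_norm_grad_sq {u : ι → H1 Ω} {r : ι → ℝ}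
    (hu : (fun t => (u t).norm) =O[l] r) :
    (fun t => √(∫ x in Ω, ‖(u t).grad x‖ ^ 2)) =O[l] r := by
  refine (IsBigO.of_bound' (Eventually.of_forall fun t => ?_)).trans hu
  rw [Real.norm_of_nonneg (Real.sqrt_nonneg _)]
  exact (u t).sqrt_integral_norm_grad_sq_le_norm.trans (le_abs_self _)

theorem eLpNorm_fn_le_norm (u : H1 Ω) :
    eLpNorm u.fn 2 (volume.restrict Ω) ≤ ENNReal.ofReal u.norm := by
  rw [u.memLp_fn.eLpNorm_eq_integral_rpow_norm two_ne_zero ENNReal.ofNat_ne_top]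
  refine ENNReal.ofReal_le_ofReal ?_
  simp only [ENNReal.toReal_ofNat, Real.rpow_two, Real.norm_eq_abs, sq_abs, ← one_div,
    ← Real.sqrt_eq_rpow]
  exact Real.sqrt_le_sqrt (le_add_of_nonneg_right (integral_nonneg fun _ => sq_nonneg _))

theorem tendstoInMeasure_fn {C : ι → H1 Ω} {c : H1 Ω}
    (h : Tendsto (fun t => (C t - c).norm) l (𝓝 0)) :
    TendstoInMeasure (volume.restrict Ω) (fun t => (C t).fn) l c.fn := by
  refine tendstoInMeasure_of_tendsto_eLpNorm (p := 2) two_ne_zero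
    (fun t => (C t).memLp_fn.1) c.memLp_fn.1 ?_
  have hnorm := ENNReal.tendsto_ofReal h
  rw [ENNReal.ofReal_zero] at hnorm
  exact tendsto_of_tendsto_of_tendsto_of_le_of_le tendsto_const_nhds hnorm
    (fun _ => zero_le) fun t => (C t - c).eLpNorm_fn_le_norm

theorem integrable_mul_inner_of_memLp_top {θ s : H1 Ω} {G : E d → E d}
    (hG : MemLp G ⊤ (volume.restrict Ω)) :
    Integrable (fun x => θ.fn x * ⟪G x, s.grad x⟫_ℝ) (volume.restrict Ω) := by
  simp only [← real_inner_smul_left]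
  exact integrable_inner_of_memLp_two (hG.smul θ.memLp_fn) s.memLp_grad

end H1

theorem tendsto_eLpNorm_sub_sub {α F : Type*} [MeasurableSpace α] [NormedAddCommGroup F]
    {μ : Measure α} {p : ENNReal} (hp : 1 ≤ p) {f g : ι → α → F} {f₀ g₀ : α → F}
    (hf : ∀ t, AEStronglyMeasurable (fun x => f t x - f₀ x) μ)
    (hg : ∀ t, AEStronglyMeasurable (fun x => g t x - g₀ x) μ)
    (hf' : Tendsto (fun t => eLpNorm (fun x => f t x - f₀ x) p μ) l (𝓝 0))
    (hg' : Tendsto (fun t => eLpNorm (fun x => g t x - g₀ x) p μ) l (𝓝 0)) :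
    Tendsto (fun t => eLpNorm (fun x => (f t x - g t x) - (f₀ x - g₀ x)) p μ) l (𝓝 0) := by
  have hfg := hf'.add hg'
  rw [add_zero] at hfg
  simp only [sub_sub_sub_comm _ (g _ _)]
  exact tendsto_of_tendsto_of_tendsto_of_le_of_le tendsto_const_nhds hfg (fun _ => zero_le)
    fun t => eLpNorm_sub_le (hf t) (hg t) hp

theorem continuous_gradient {F : Type*} [NormedAddCommGroup F] [InnerProductSpace ℝ F]
    [CompleteSpace F] {v : F → ℝ} (hv : ContDiff ℝ 1 v) : Continuous (gradient v) :=
  (InnerProductSpace.toDual ℝ F).symm.continuous.comp (hv.continuous_fderiv one_ne_zero)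

theorem gradient_sub {F : Type*} [NormedAddCommGroup F] [InnerProductSpace ℝ F]
    [CompleteSpace F] {v w : F → ℝ} {x : F} (hv : DifferentiableAt ℝ v x)
    (hw : DifferentiableAt ℝ w x) :
    gradient (fun y => v y - w y) x = gradient v x - gradient w x := by
  simp only [gradient, fderiv_fun_sub hv hw, map_sub]

theorem HasTrace.sub {u w : H1 Ω} {h k : E d → ℝ} (hu : HasTrace u h) (hw : HasTrace w k) :
    HasTrace (u - w) (fun x => h x - k x) := by
  obtain ⟨hh, v, hv, hvu, hvu', hvh⟩ := hu
  obtain ⟨hk, y, hy, hyw, hyw', hyk⟩ := hw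
  have one_le_infty : (1 : WithTop ℕ∞) ≤ ∞ := by exact_mod_cast le_top
  refine ⟨hh.sub hk, fun n x => v n x - y n x, fun n => (hv n).sub (hy n), ?_, ?_, ?_⟩
  · exact tendsto_eLpNorm_sub_sub one_le_two
      (fun n => (hv n).continuous.aestronglyMeasurable.sub u.memLp_fn.1)
      (fun n => (hy n).continuous.aestronglyMeasurable.sub w.memLp_fn.1) hvu hyw
  · have hgrad n x : gradient (fun y' => v n y' - y n y') x = gradient (v n) x - gradient (y n) x :=
      gradient_sub ((hv n).differentiable (by simp) x) ((hy n).differentiable (by simp) x)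
    simp only [hgrad]
    exact tendsto_eLpNorm_sub_sub one_le_two
      (fun n => (continuous_gradient ((hv n).of_le one_le_infty)).aestronglyMeasurable.sub
        u.memLp_grad.1)
      (fun n => (continuous_gradient ((hy n).of_le one_le_infty)).aestronglyMeasurable.sub
        w.memLp_grad.1) hvu' hyw'
  · exact tendsto_eLpNorm_sub_sub one_le_two
      (fun n => (hv n).continuous.aestronglyMeasurable.sub hh.1)
      (fun n => (hy n).continuous.aestronglyMeasurable.sub hk.1) hvh hyk

theorem ZeroOn.sub {u w : H1 Ω} (hu : ZeroOn Γ u) (hw : ZeroOn Γ w) : ZeroOn Γ (u - w) := by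
  obtain ⟨h, hh, h0⟩ := hu
  obtain ⟨k, hk, k0⟩ := hw
  refine ⟨_, hh.sub hk, ?_⟩
  filter_upwards [h0, k0] with x hx kx hΓ
  rw [hx hΓ, kx hΓ, sub_zero]

theorem ZeroOn.sub_of_sub {u w g : H1 Ω} (hu : ZeroOn Γ (u - g)) (hw : ZeroOn Γ (w - g)) :
    ZeroOn Γ (u - w) := by
  simpa using hu.sub hw

end Sobolev

section Duality

variable {d : ℕ} {Ω : Set (E d)}

/-- The density of the contribution of one species of valence `zi`, with adjoint concentration `s`,
to the increment of the objective when the phase field changes from `φ` to `φ'` and the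
concentration and the potential change from `(c, ψ)` to `(C, Ψ)`. -/
def speciesIncrement (P : Params) (zi : ℝ) (φ φ' c C ψ Ψ s : H1 Ω) (x : E d) : ℝ :=
  P.D (φ.fn x) * P.α₀ * C.fn x * ⟪(φ' - φ).grad x, s.grad x⟫_ℝ
    - (P.D (φ'.fn x) - P.D (φ.fn x)) * ⟪flux P zi φ' C Ψ x, s.grad x⟫_ℝ
    - P.D (φ.fn x) * zi * (C - c).fn x * ⟪(Ψ - ψ).grad x, s.grad x⟫_ℝ

/-- The density of the contribution of the potential, with adjoint potential `ζ`, to the increment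
of the objective when the phase field changes from `φ` to `φ'` and the potential becomes `Ψ`. -/
def potentialIncrement (P : Params) (φ φ' Ψ ζ : H1 Ω) (x : E d) : ℝ :=
  (P.ε (φ'.fn x) - P.ε (φ.fn x)) * ⟪Ψ.grad x, ζ.grad x⟫_ℝ

/-- The density of the contribution of one species to `sensitivity`: the part of `speciesIncrement`
that is of first order in the direction `θ`, where `dD` stands for `⟨D'(φ), θ⟩`. -/
def speciesSensitivity (P : Params) (zi : ℝ) (φ θ : H1 Ω) (dD : E d → ℝ) (c ψ s : H1 Ω)
    (x : E d) : ℝ :=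
  P.D (φ.fn x) * P.α₀ * c.fn x * ⟪θ.grad x, s.grad x⟫_ℝ
    - dD x * ⟪flux P zi φ c ψ x, s.grad x⟫_ℝ

theorem hasIntegral_J [IsFiniteMeasure (volume.restrict Ω)] (c : Fin 2 → H1 Ω) :
    HasIntegral (fun x => -∑ i, z i * (c i).fn x) (J c) (volume.restrict Ω) :=
  ⟨(integrable_finsetSum _ fun i _ =>
    ((c i).memLp_fn.integrable one_le_two).const_mul (z i)).neg, rfl⟩

theorem hasIntegral_J_sub_J [IsFiniteMeasure (volume.restrict Ω)] {P : Params} {Γ : Set (E d)}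
    {cinf c C s : Fin 2 → H1 Ω} {g φ φ' ψ Ψ ζ : H1 Ω} (hadj : IsAdjointSolution P Γ φ c ψ s ζ)
    (h : IsPNPSolution P Γ cinf g φ c ψ) (h' : IsPNPSolution P Γ cinf g φ' C Ψ) :
    HasIntegral (fun x => (∑ i, speciesIncrement P (z i) φ φ' (c i) (C i) ψ Ψ (s i) x)
      - potentialIncrement P φ φ' Ψ ζ x) (J C - J c) (volume.restrict Ω) := by
  obtain ⟨hs, hζ, adjoint_species, adjoint_potential⟩ := hadj
  obtain ⟨hc, hψ, species, poisson⟩ := h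
  obtain ⟨hC, hΨ, species', poisson'⟩ := h'
  obtain ⟨int_ε, int_D, int_eq_zero⟩ := adjoint_potential _ (hΨ.sub_of_sub hψ)
  have adjoint_potential_tested := HasIntegral.add ⟨int_ε, rfl⟩
    (HasIntegral.sum fun i => ⟨int_D i, rfl⟩)
  rw [int_eq_zero] at adjoint_potential_tested
  have adjoint_species_tested := HasIntegral.sum fun i =>
    adjoint_species i _ ((hC i).sub_of_sub (hc i))
  have species_tested := HasIntegral.sum fun i =>
    HasIntegral.sub (species' i _ (hs i)) (species i _ (hs i))
  have poisson_tested := HasIntegral.sub (poisson' ζ hζ) (poisson ζ hζ)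
  have total := (((((hasIntegral_J C).sub (hasIntegral_J c)).add adjoint_species_tested).add
    adjoint_potential_tested).sub species_tested).sub poisson_tested
  convert total using 1
  · ext x
    simp only [Fin.sum_univ_two, speciesIncrement, potentialIncrement, flux, H1.fn_sub,
      H1.grad_sub, inner_add_left, inner_sub_left, inner_add_right, inner_sub_right,
      real_inner_smul_left, real_inner_smul_right]
    simp only [real_inner_comm]
    ring
  · simp only [Finset.sum_const_zero, sub_zero, add_zero]

variable {P : Params} {φ θ : H1 Ω} {dD dD' dε dε' : E d → ℝ} {c s : Fin 2 → H1 Ω} {ψ ζ : H1 Ω}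

theorem SensitivityIntegrable.hasIntegral_sensitivity
    (h : SensitivityIntegrable P φ θ dD dε c ψ s ζ) :
    HasIntegral (fun x => (∑ i, speciesSensitivity P (z i) φ θ dD (c i) ψ (s i) x)
      - dε x * ⟪ψ.grad x, ζ.grad x⟫_ℝ) (sensitivity P φ θ dD dε c ψ s ζ) (volume.restrict Ω) := by
  obtain ⟨int_dD, int_dε, int_θ⟩ := h
  have total := (HasIntegral.sum fun i =>
    HasIntegral.sub ⟨int_θ i, rfl⟩ ⟨int_dD i, rfl⟩).sub ⟨int_dε, rfl⟩
  refine ⟨total.1, total.2.trans ?_⟩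
  rw [sensitivity, Finset.sum_sub_distrib]
  ring

theorem SensitivityIntegrable.congr (h : SensitivityIntegrable P φ θ dD dε c ψ s ζ)
    (hD : dD =ᵐ[volume.restrict Ω] dD') (hε : dε =ᵐ[volume.restrict Ω] dε') :
    SensitivityIntegrable P φ θ dD' dε' c ψ s ζ :=
  ⟨fun i => (h.1 i).congr (hD.mul .rfl), h.2.1.congr (hε.mul .rfl), h.2.2⟩

theorem sensitivity_congr (hD : dD =ᵐ[volume.restrict Ω] dD')
    (hε : dε =ᵐ[volume.restrict Ω] dε') :
    sensitivity P φ θ dD dε c ψ s ζ = sensitivity P φ θ dD' dε' c ψ s ζ := by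
  have hDi i : ∫ x in Ω, dD x * ⟪flux P (z i) φ (c i) ψ x, (s i).grad x⟫_ℝ =
      ∫ x in Ω, dD' x * ⟪flux P (z i) φ (c i) ψ x, (s i).grad x⟫_ℝ :=
    integral_congr_ae (hD.mul .rfl)
  have hεi : ∫ x in Ω, dε x * ⟪ψ.grad x, ζ.grad x⟫_ℝ = ∫ x in Ω, dε' x * ⟪ψ.grad x, ζ.grad x⟫_ℝ :=
    integral_congr_ae (hε.mul .rfl)
  simp only [sensitivity, hDi, hεi]

end Duality

section Sensitivity

open Asymptotics

variable {d : ℕ} {Ω Γ : Set (E d)} {P : Params} {φ θ c ψ s ζ : H1 Ω} {C Ψ : ℝ → H1 Ω}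
  {S : Set ℝ} {l : Filter ℝ} [l.IsCountablyGenerated]

theorem isLittleOL1_potentialIncrement_sub (hl : l ≤ 𝓝[S] 0)
    (hε : ∀ᵐ x ∂(volume.restrict Ω), HasDerivWithinAt (fun t => P.ε (φ.fn x + t * θ.fn x))
      (dirDeriv P.ε (φ.fn x) (θ.fn x)) S 0)
    (hΨ : (fun t => (Ψ t - ψ).norm) =O[l] fun t => t)
    (hθψ : IntegrableOn (fun x => θ.fn x * ⟪ψ.grad x, ζ.grad x⟫_ℝ) Ω) :
    IsLittleOL1 (volume.restrict Ω) l (fun t x => potentialIncrement P φ (φ + t • θ) (Ψ t) ζ x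
      - t * (dirDeriv P.ε (φ.fn x) (θ.fn x) * ⟪ψ.grad x, ζ.grad x⟫_ℝ)) fun t => t := by
  obtain ⟨M, L, law⟩ := P.exists_isMaterialLaw_ε
  have hε_tendsto := law.boundedlyTendstoAE φ.memLp_fn.1 θ.memLp_fn.1
    (hl.trans nhdsWithin_le_nhds)
  have coefficient_term := law.isLittleOL1_increment_mul φ.memLp_fn.1 θ.memLp_fn.1 hl hε
    (.const 1) (ψ.memLp_grad.1.inner ζ.memLp_grad.1) hθψ
  have gradient_term := hε_tendsto.sub_limit.isLittleOL1_mul_inner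
    (fun t => (Ψ t - ψ).memLp_grad) (H1.isBigO_sqrt_integral_norm_grad_sq hΨ) ζ.memLp_grad
  convert coefficient_term.add gradient_term using 1
  ext t x
  simp only [potentialIncrement, H1.fn_add, H1.fn_smul, H1.grad_sub, inner_sub_left]
  ring

theorem isLittleOL1_speciesIncrement_sub_of_boundedlyTendstoAE (zi : ℝ) (hl : l ≤ 𝓝[S] 0)
    (hD : ∀ᵐ x ∂(volume.restrict Ω), HasDerivWithinAt (fun t => P.D (φ.fn x + t * θ.fn x))
      (dirDeriv P.D (φ.fn x) (θ.fn x)) S 0)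
    (hC : (fun t => (C t - c).norm) =O[l] fun t => t)
    (hΨ : (fun t => (Ψ t - ψ).norm) =O[l] fun t => t)
    (hCc : BoundedlyTendstoAE (volume.restrict Ω) (fun t => (C t).fn) l c.fn)
    (hθc : IntegrableOn (fun x => θ.fn x * ⟪c.grad x, s.grad x⟫_ℝ) Ω)
    (hθψ : IntegrableOn (fun x => θ.fn x * ⟪ψ.grad x, s.grad x⟫_ℝ) Ω)
    (hθφ : IntegrableOn (fun x => θ.fn x * ⟪φ.grad x, s.grad x⟫_ℝ) Ω) :
    IsLittleOL1 (volume.restrict Ω) l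
      (fun t x => speciesIncrement P zi φ (φ + t • θ) c (C t) ψ (Ψ t) s x
        - t * speciesSensitivity P zi φ θ (fun x => dirDeriv P.D (φ.fn x) (θ.fn x)) c ψ s x)
      fun t => t := by
  obtain ⟨M, L, law⟩ := P.exists_isMaterialLaw_D
  have hD_tendsto := law.boundedlyTendstoAE φ.memLp_fn.1 θ.memLp_fn.1
    (hl.trans nhdsWithin_le_nhds)
  have hDC_tendsto := (hD_tendsto.mul hCc).sub_limit
  have diffusion_term := law.isLittleOL1_increment_mul φ.memLp_fn.1 θ.memLp_fn.1 hl hD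
    (.const 1) (c.memLp_grad.1.inner s.memLp_grad.1) hθc
  have drift_term := law.isLittleOL1_increment_mul φ.memLp_fn.1 θ.memLp_fn.1 hl hD
    hCc (ψ.memLp_grad.1.inner s.memLp_grad.1) hθψ
  have repulsion_term := law.isLittleOL1_increment_mul φ.memLp_fn.1 θ.memLp_fn.1 hl hD
    hCc (φ.memLp_grad.1.inner s.memLp_grad.1) hθφ
  have direction_term := hDC_tendsto.isLittleOL1_mul (r := fun t => t)
    (integrable_inner_of_memLp_two θ.memLp_grad s.memLp_grad)
  have concentration_term := hD_tendsto.sub_limit.isLittleOL1_mul_inner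
    (fun t => (C t - c).memLp_grad) (H1.isBigO_sqrt_integral_norm_grad_sq hC) s.memLp_grad
  have potential_term := hDC_tendsto.isLittleOL1_mul_inner
    (fun t => (Ψ t - ψ).memLp_grad) (H1.isBigO_sqrt_integral_norm_grad_sq hΨ) s.memLp_grad
  convert ((repulsion_term.add direction_term).const_smul P.α₀).sub
    ((diffusion_term.add concentration_term).add
      ((drift_term.add potential_term).const_smul zi)) using 1
  ext t x
  simp only [speciesIncrement, speciesSensitivity, flux, H1.fn_add, H1.fn_sub, H1.fn_smul,
    H1.grad_add, H1.grad_sub, H1.grad_smul, inner_add_left, inner_sub_left, real_inner_smul_left,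
    add_sub_cancel_left, smul_add, smul_eq_mul]
  ring

theorem isLittleOL1_speciesIncrement_sub (zi : ℝ) (hl : l ≤ 𝓝[S] 0)
    (hD : ∀ᵐ x ∂(volume.restrict Ω), HasDerivWithinAt (fun t => P.D (φ.fn x + t * θ.fn x))
      (dirDeriv P.D (φ.fn x) (θ.fn x)) S 0)
    (hC : (fun t => (C t - c).norm) =O[l] fun t => t)
    (hΨ : (fun t => (Ψ t - ψ).norm) =O[l] fun t => t) {M : ℝ}
    (hCM : ∀ᶠ t in l, ∀ᵐ x ∂(volume.restrict Ω), |(C t).fn x| ≤ M)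
    (hcM : ∀ᵐ x ∂(volume.restrict Ω), |c.fn x| ≤ M)
    (hθc : IntegrableOn (fun x => θ.fn x * ⟪c.grad x, s.grad x⟫_ℝ) Ω)
    (hθψ : IntegrableOn (fun x => θ.fn x * ⟪ψ.grad x, s.grad x⟫_ℝ) Ω)
    (hθφ : IntegrableOn (fun x => θ.fn x * ⟪φ.grad x, s.grad x⟫_ℝ) Ω) :
    IsLittleOL1 (volume.restrict Ω) l
      (fun t x => speciesIncrement P zi φ (φ + t • θ) c (C t) ψ (Ψ t) s x
        - t * speciesSensitivity P zi φ θ (fun x => dirDeriv P.D (φ.fn x) (θ.fn x)) c ψ s x)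
      fun t => t := by
  have hC₀ : Tendsto (fun t => (C t - c).norm) l (𝓝 0) :=
    hC.trans_tendsto (hl.trans nhdsWithin_le_nhds)
  refine .of_tendstoInMeasure (H1.tendstoInMeasure_fn hC₀) fun l' hl' _ hae =>
    isLittleOL1_speciesIncrement_sub_of_boundedlyTendstoAE zi (hl'.trans hl) hD (hC.mono hl')
      (hΨ.mono hl') ?_ hθc hθψ hθφ
  exact ⟨fun t => (C t).memLp_fn.1, c.memLp_fn.1, ⟨M, hl' hCM, hcM⟩, hae⟩

end Sensitivity

section Theorem

open Asymptotics

variable {d : ℕ} {Ω Γ : Set (E d)} {P : Params} {φ θ : H1 Ω}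

theorem integrable_dirDeriv_mul_inner_flux {c ψ s : H1 Ω} {M : ℝ} (zi : ℝ)
    (hcM : ∀ᵐ x ∂(volume.restrict Ω), |c.fn x| ≤ M)
    (hθc : IntegrableOn (fun x => θ.fn x * ⟪c.grad x, s.grad x⟫_ℝ) Ω)
    (hθψ : IntegrableOn (fun x => θ.fn x * ⟪ψ.grad x, s.grad x⟫_ℝ) Ω)
    (hθφ : IntegrableOn (fun x => θ.fn x * ⟪φ.grad x, s.grad x⟫_ℝ) Ω) :
    IntegrableOn
      (fun x => dirDeriv P.D (φ.fn x) (θ.fn x) * ⟪flux P zi φ c ψ x, s.grad x⟫_ℝ) Ω := by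
  obtain ⟨_, L, law⟩ := P.exists_isMaterialLaw_D
  have flux_aestronglyMeasurable :
      AEStronglyMeasurable (fun x => flux P zi φ c ψ x) (volume.restrict Ω) :=
    (c.memLp_grad.1.add ((c.memLp_fn.1.const_mul zi).smul ψ.memLp_grad.1)).sub
      ((c.memLp_fn.1.const_mul P.α₀).smul φ.memLp_grad.1)
  refine law.integrable_dirDeriv_mul φ.memLp_fn.1 θ.memLp_fn.1
    (flux_aestronglyMeasurable.inner s.memLp_grad.1) ?_
  have hθψ' := (hθψ.bdd_mul c.memLp_fn.1 hcM).const_mul zi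
  have hθφ' := (hθφ.bdd_mul c.memLp_fn.1 hcM).const_mul P.α₀
  refine ((hθc.add hθψ').sub hθφ').congr (Eventually.of_forall fun x => ?_)
  simp only [Pi.add_apply, Pi.sub_apply, flux, inner_add_left, inner_sub_left,
    real_inner_smul_left]
  ring

theorem integrable_D_mul_inner_grad {c s : H1 Ω} {M : ℝ}
    (hcM : ∀ᵐ x ∂(volume.restrict Ω), |c.fn x| ≤ M) :
    IntegrableOn (fun x => P.D (φ.fn x) * P.α₀ * c.fn x * ⟪θ.grad x, s.grad x⟫_ℝ) Ω := by
  obtain ⟨N, L, law⟩ := P.exists_isMaterialLaw_D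
  have hc := (integrable_inner_of_memLp_two θ.memLp_grad s.memLp_grad).bdd_mul c.memLp_fn.1 hcM
  have hD := hc.bdd_mul (law.lipschitz.continuous.comp_aestronglyMeasurable φ.memLp_fn.1)
    (Eventually.of_forall fun x => law.abs_le (φ.fn x))
  refine (hD.const_mul P.α₀).congr (Eventually.of_forall fun x => ?_)
  dsimp only
  ring

variable {cinf s : Fin 2 → H1 Ω} {g ζ : H1 Ω} {c : H1 Ω → Fin 2 → H1 Ω} {ψ : H1 Ω → H1 Ω}
  {S : Set ℝ}

namespace RegularStateAlong

theorem isPNPSolution (h : RegularStateAlong P Γ cinf g c ψ φ θ (𝓝[S] 0)) (hS : 0 ∈ S) :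
    IsPNPSolution P Γ cinf g φ (c φ) (ψ φ) := by
  simpa using h.1.self_of_nhdsWithin hS

theorem exists_bound (h : RegularStateAlong P Γ cinf g c ψ φ θ (𝓝[S] 0)) (hS : 0 ∈ S) :
    ∃ M : ℝ, (∀ᶠ t in 𝓝[S] 0, ∀ i, ∀ᵐ x ∂(volume.restrict Ω), |(c (φ + t • θ) i).fn x| ≤ M) ∧
      ∀ i, ∀ᵐ x ∂(volume.restrict Ω), |(c φ i).fn x| ≤ M := by
  obtain ⟨M, hM⟩ := h.2.1
  exact ⟨M, hM, by simpa using hM.self_of_nhdsWithin hS⟩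

theorem sensitivityIntegrable (h : RegularStateAlong P Γ cinf g c ψ φ θ (𝓝[S] 0)) (hS : 0 ∈ S)
    (hθφ : ∀ i, IntegrableOn (fun x => θ.fn x * ⟪φ.grad x, (s i).grad x⟫_ℝ) Ω)
    (hθc : ∀ i, IntegrableOn (fun x => θ.fn x * ⟪(c φ i).grad x, (s i).grad x⟫_ℝ) Ω)
    (hθψ : ∀ i, IntegrableOn (fun x => θ.fn x * ⟪(ψ φ).grad x, (s i).grad x⟫_ℝ) Ω)
    (hθζ : IntegrableOn (fun x => θ.fn x * ⟪(ψ φ).grad x, ζ.grad x⟫_ℝ) Ω) :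
    SensitivityIntegrable P φ θ (fun x => dirDeriv P.D (φ.fn x) (θ.fn x))
      (fun x => dirDeriv P.ε (φ.fn x) (θ.fn x)) (c φ) (ψ φ) s ζ := by
  obtain ⟨M, -, hM⟩ := h.exists_bound hS
  obtain ⟨_, _, law⟩ := P.exists_isMaterialLaw_ε
  exact ⟨fun i => integrable_dirDeriv_mul_inner_flux (z i) (hM i) (hθc i) (hθψ i) (hθφ i),
    law.integrable_dirDeriv_mul φ.memLp_fn.1 θ.memLp_fn.1
      ((ψ φ).memLp_grad.1.inner ζ.memLp_grad.1) hθζ,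
    fun i => integrable_D_mul_inner_grad (hM i)⟩

theorem hasDerivWithinAt_J [IsFiniteMeasure (volume.restrict Ω)]
    (h : RegularStateAlong P Γ cinf g c ψ φ θ (𝓝[S] 0)) (hS : 0 ∈ S)
    (hadj : IsAdjointSolution P Γ φ (c φ) (ψ φ) s ζ)
    (hθφ : ∀ i, IntegrableOn (fun x => θ.fn x * ⟪φ.grad x, (s i).grad x⟫_ℝ) Ω)
    (hθc : ∀ i, IntegrableOn (fun x => θ.fn x * ⟪(c φ i).grad x, (s i).grad x⟫_ℝ) Ω)
    (hθψ : ∀ i, IntegrableOn (fun x => θ.fn x * ⟪(ψ φ).grad x, (s i).grad x⟫_ℝ) Ω)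
    (hθζ : IntegrableOn (fun x => θ.fn x * ⟪(ψ φ).grad x, ζ.grad x⟫_ℝ) Ω)
    (hD : ∀ᵐ x ∂(volume.restrict Ω), HasDerivWithinAt (fun t => P.D (φ.fn x + t * θ.fn x))
      (dirDeriv P.D (φ.fn x) (θ.fn x)) S 0)
    (hε : ∀ᵐ x ∂(volume.restrict Ω), HasDerivWithinAt (fun t => P.ε (φ.fn x + t * θ.fn x))
      (dirDeriv P.ε (φ.fn x) (θ.fn x)) S 0) :
    HasDerivWithinAt (fun t : ℝ => J (c (φ + t • θ)))
      (sensitivity P φ θ (fun x => dirDeriv P.D (φ.fn x) (θ.fn x))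
        (fun x => dirDeriv P.ε (φ.fn x) (θ.fn x)) (c φ) (ψ φ) s ζ) S 0 := by
  obtain ⟨M, hM, hM₀⟩ := h.exists_bound hS
  have species i := isLittleOL1_speciesIncrement_sub (z i) le_rfl hD (h.2.2.1 i) h.2.2.2
    (hM.mono fun t ht => ht i) (hM₀ i) (hθc i) (hθψ i) (hθφ i)
  have potential := isLittleOL1_potentialIncrement_sub le_rfl hε h.2.2.2 hθζ
  have remainder := (((species 0).add (species 1)).sub potential).isLittleO_integral
  have first_order := (h.sensitivityIntegrable hS hθφ hθc hθψ hθζ).hasIntegral_sensitivity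
  rw [hasDerivWithinAt_iff_isLittleO]
  simp only [sub_zero, zero_smul, add_zero, smul_eq_mul]
  refine remainder.congr' ?_ .rfl
  filter_upwards [h.1] with t ht
  have increment := hasIntegral_J_sub_J hadj (h.isPNPSolution hS) ht
  rw [← (increment.sub (first_order.const_mul t)).2]
  refine integral_congr_ae (ae_of_all _ fun x => ?_)
  simp only [Fin.sum_univ_two]
  ring

end RegularStateAlong

end Theorem

end PNP

end

theorem mainTheorem2_general {d : ℕ} (P : PNP.Params) {Ω : Set (PNP.E d)} (hΩ : volume Ω ≠ ⊤)
    {Γ : Set (PNP.E d)} {cinf : Fin 2 → PNP.H1 Ω} {g φ θ : PNP.H1 Ω}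
    {c : PNP.H1 Ω → Fin 2 → PNP.H1 Ω} {ψ : PNP.H1 Ω → PNP.H1 Ω}
    {s : Fin 2 → PNP.H1 Ω} {ζ : PNP.H1 Ω} (hadj : PNP.IsAdjointSolution P Γ φ (c φ) (ψ φ) s ζ)
    (hθφ : ∀ i, IntegrableOn (fun x => θ.fn x * inner ℝ (φ.grad x) ((s i).grad x)) Ω)
    (hθc : ∀ i, IntegrableOn (fun x => θ.fn x * inner ℝ ((c φ i).grad x) ((s i).grad x)) Ω)
    (hθψ : ∀ i, IntegrableOn (fun x => θ.fn x * inner ℝ ((ψ φ).grad x) ((s i).grad x)) Ω)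
    (hθζ : IntegrableOn (fun x => θ.fn x * inner ℝ ((ψ φ).grad x) (ζ.grad x)) Ω) :
    (PNP.RegularStateAlong P Γ cinf g c ψ φ θ (𝓝[≥] 0) →
      PNP.SensitivityIntegrable P φ θ (fun x => PNP.dirDeriv P.D (φ.fn x) (θ.fn x))
        (fun x => PNP.dirDeriv P.ε (φ.fn x) (θ.fn x)) (c φ) (ψ φ) s ζ ∧
      HasDerivWithinAt (fun t : ℝ => PNP.J (c (φ + t • θ)))
        (PNP.sensitivity P φ θ (fun x => PNP.dirDeriv P.D (φ.fn x) (θ.fn x))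
          (fun x => PNP.dirDeriv P.ε (φ.fn x) (θ.fn x)) (c φ) (ψ φ) s ζ) (Ici 0) 0) ∧
    (PNP.RegularStateAlong P Γ cinf g c ψ φ θ (𝓝 0) →
      (∀ᵐ x ∂(volume.restrict Ω), θ.fn x = 0 ∨
        DifferentiableAt ℝ P.D (φ.fn x) ∧ DifferentiableAt ℝ P.ε (φ.fn x)) →
      PNP.SensitivityIntegrable P φ θ (fun x => deriv P.D (φ.fn x) * θ.fn x)
        (fun x => deriv P.ε (φ.fn x) * θ.fn x) (c φ) (ψ φ) s ζ ∧
      HasDerivAt (fun t : ℝ => PNP.J (c (φ + t • θ)))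
        (PNP.sensitivity P φ θ (fun x => deriv P.D (φ.fn x) * θ.fn x)
          (fun x => deriv P.ε (φ.fn x) * θ.fn x) (c φ) (ψ φ) s ζ) 0) := by
  have : IsFiniteMeasure (volume.restrict Ω) := isFiniteMeasure_restrict.2 hΩ
  obtain ⟨_, _, lawD⟩ := P.exists_isMaterialLaw_D
  obtain ⟨_, _, lawε⟩ := P.exists_isMaterialLaw_ε
  refine ⟨fun h => ⟨h.sensitivityIntegrable self_mem_Ici hθφ hθc hθψ hθζ,
    h.hasDerivWithinAt_J self_mem_Ici hadj hθφ hθc hθψ hθζ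
      (ae_of_all _ fun x => lawD.hasDerivWithinAt_line (φ.fn x) (θ.fn x))
      (ae_of_all _ fun x => lawε.hasDerivWithinAt_line (φ.fn x) (θ.fn x))⟩, fun h hdiff => ?_⟩
  have diffD : ∀ᵐ x ∂(volume.restrict Ω), θ.fn x = 0 ∨ DifferentiableAt ℝ P.D (φ.fn x) :=
    hdiff.mono fun x hx => hx.imp_right And.left
  have diffε : ∀ᵐ x ∂(volume.restrict Ω), θ.fn x = 0 ∨ DifferentiableAt ℝ P.ε (φ.fn x) :=
    hdiff.mono fun x hx => hx.imp_right And.right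
  have dirDerivD := diffD.mono fun x hx => PNP.dirDeriv_eq_deriv_mul hx
  have dirDerivε := diffε.mono fun x hx => PNP.dirDeriv_eq_deriv_mul hx
  rw [← nhdsWithin_univ] at h
  refine ⟨(h.sensitivityIntegrable (mem_univ 0) hθφ hθc hθψ hθζ).congr dirDerivD dirDerivε, ?_⟩
  rw [← PNP.sensitivity_congr dirDerivD dirDerivε, ← hasDerivWithinAt_univ]
  refine h.hasDerivWithinAt_J (mem_univ 0) hadj hθφ hθc hθψ hθζ ?_ ?_
  · filter_upwards [diffD] with x hx
    exact PNP.dirDeriv_eq_deriv_mul hx ▸ (PNP.hasDerivAt_line hx).hasDerivWithinAt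
  · filter_upwards [diffε] with x hx
    exact PNP.dirDeriv_eq_deriv_mul hx ▸ (PNP.hasDerivAt_line hx).hasDerivWithinAt

theorem mainTheorem2 {d : ℕ} (hd : d = 2 ∨ d = 3) (P : PNP.Params)
    (Ω : Set (PNP.E d)) (hΩo : IsOpen Ω) (hΩb : Bornology.IsBounded Ω)
    (hΩL : PNP.HasLipschitzBoundary Ω)
    (Γin Γ₁ Γ₂ : Set (PNP.E d)) (h₁ : Disjoint Γin Γ₁) (h₂ : Disjoint Γin Γ₂)
    (h₃ : Disjoint Γ₁ Γ₂) (hΓ : frontier Ω = closure Γin ∪ closure Γ₁ ∪ closure Γ₂)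
    -- Dirichlet data, phase field, direction, and the control-to-state map `(c, ψ)`
    (cinf : Fin 2 → PNP.H1 Ω) (g : PNP.H1 Ω)
    (φ : PNP.H1 Ω) (hφ : φ.MemW1Inf) (θ : PNP.H1 Ω)
    (c : PNP.H1 Ω → Fin 2 → PNP.H1 Ω) (ψ : PNP.H1 Ω → PNP.H1 Ω)
    -- the adjoint state
    (s : Fin 2 → PNP.H1 Ω) (ζ : PNP.H1 Ω)
    (hadj : PNP.IsAdjointSolution P (Γin ∪ Γ₂) φ (c φ) (ψ φ) s ζ)
    -- the products in the claimed formula are integrable (automatic for every `θ ∈ H¹(Ω)`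
    -- if `∇c`, `∇ψ` lie in `L⁴(Ω)`)
    (hθc : ∀ i, IntegrableOn
      (fun x => θ.fn x * inner ℝ ((c φ i).grad x) ((s i).grad x)) Ω)
    (hθψ : ∀ i, IntegrableOn
      (fun x => θ.fn x * inner ℝ ((ψ φ).grad x) ((s i).grad x)) Ω)
    (hθζ : IntegrableOn (fun x => θ.fn x * inner ℝ ((ψ φ).grad x) (ζ.grad x)) Ω) :
    -- one-sided derivative, for all `φ` and `θ`
    (PNP.RegularStateAlong P (Γin ∪ Γ₂) cinf g c ψ φ θ (𝓝[≥] 0) →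
      PNP.SensitivityIntegrable P φ θ (fun x => PNP.dirDeriv P.D (φ.fn x) (θ.fn x))
        (fun x => PNP.dirDeriv P.ε (φ.fn x) (θ.fn x)) (c φ) (ψ φ) s ζ ∧
      HasDerivWithinAt (fun t : ℝ => PNP.J (c (φ + t • θ)))
        (PNP.sensitivity P φ θ (fun x => PNP.dirDeriv P.D (φ.fn x) (θ.fn x))
          (fun x => PNP.dirDeriv P.ε (φ.fn x) (θ.fn x)) (c φ) (ψ φ) s ζ) (Ici 0) 0) ∧
    -- two-sided derivative, where `D` and `ε` are differentiable at `φ` in direction `θ`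
    (PNP.RegularStateAlong P (Γin ∪ Γ₂) cinf g c ψ φ θ (𝓝 0) →
      (∀ᵐ x ∂(volume.restrict Ω), θ.fn x = 0 ∨
        DifferentiableAt ℝ P.D (φ.fn x) ∧ DifferentiableAt ℝ P.ε (φ.fn x)) →
      PNP.SensitivityIntegrable P φ θ (fun x => deriv P.D (φ.fn x) * θ.fn x)
        (fun x => deriv P.ε (φ.fn x) * θ.fn x) (c φ) (ψ φ) s ζ ∧
      HasDerivAt (fun t : ℝ => PNP.J (c (φ + t • θ)))
        (PNP.sensitivity P φ θ (fun x => deriv P.D (φ.fn x) * θ.fn x)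
          (fun x => deriv P.ε (φ.fn x) * θ.fn x) (c φ) (ψ φ) s ζ) 0) :=
  mainTheorem2_general P hΩb.measure_lt_top.ne hadj
    (fun _ => PNP.H1.integrable_mul_inner_of_memLp_top hφ.2) hθc hθψ hθζ
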